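/- For an integer $n\ge 1$ let $\mathbb{T}(n)$ be the set of all labeled trees on $n$ labeled nodes; by Cayley's formula $|\mathbb{T}(n)|=n^{n-2}$. For $T_1,T_2\in\mathbb{T}(n)$ with edge sets $E_1,E_2$, the tree distance is $d_{\mathcal T}(T_1,T_2)=n-1-|E_1\cap E_2|$. For an integer $t\ge 0$ and $T\in\mathbb{T}(n)$ let $$V_T(n,t)=\bigl|\{T'\in\mathbb{T}(n) : d_{\mathcal T}(T',T)\le t\}\bigr|$$ be the size of the ball of radius $t$ centered at $T$, and let the average ball size be $$V(n,t)=\frac{1}{n^{n-2}}\sum_{T\in\mathbb{T}(n)}V_T(n,t).$$ Then: 1. For every fixed integer $t\ge 0$, $V(n,t)=\Theta(n^{2.5t})$ as $n\to\infty$; that is, there are constants $c_t,C_t>0$, depending only on $t$, such that $c_t\,n^{2.5t}\le V(n,t)\le C_t\,n^{2.5t}$ for all sufficiently large $n$. 2. For radius one, $$\lim_{n\to\infty}\frac{V(n,1)}{\tfrac12\sqrt{\pi/2}\;n^{2.5}}=1 .$$ -/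

import Mathlib

open Filter Topology Asymptotics

/-- The set of all labeled trees on the `n` labeled nodes `0, 1, …, n - 1`. -/
abbrev LabeledTree (n : ℕ) : Type := {G : SimpleGraph (Fin n) // G.IsTree}

noncomputable instance instFintypeLabeledTree (n : ℕ) : Fintype (LabeledTree n) :=
  Fintype.ofFinite _

/-- The tree distance `n - 1 - |E₁ ∩ E₂|`, computed in `ℤ` so that no subtraction is truncated. -/
noncomputable def treeDist {n : ℕ} (T₁ T₂ : LabeledTree n) : ℤ :=
  (n : ℤ) - 1 - ((T₁.val.edgeSet ∩ T₂.val.edgeSet).ncard : ℤ)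

/-- The tree ball of trees of radius `t` centered at `T`. -/
def treeBall {n : ℕ} (T : LabeledTree n) (t : ℕ) : Set (LabeledTree n) :=
  {T' | treeDist T' T ≤ (t : ℤ)}

/-- The size of the tree ball of trees of radius `t` centered at `T`. -/
noncomputable def treeBallSize {n : ℕ} (T : LabeledTree n) (t : ℕ) : ℕ :=
  (treeBall T t).ncard

/-- The average ball size: the sum of all ball sizes divided by `n ^ (n - 2)`, the number of
labeled trees (the exponent is an integer, so it is not truncated at `n = 1`). -/
noncomputable def averageBallSize (n t : ℕ) : ℝ :=
  (∑ T : LabeledTree n, (treeBallSize T t : ℝ)) / (n : ℝ) ^ ((n : ℤ) - 2)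

/-! Multiplied by `n ^ (n - 2)`, the average ball size counts ordered pairs of trees sharing at
least `m = n - 1 - t` edges. A smoother count is the sum over pairs of the binomial coefficient of
`j` over `m`, where `j` is the number of common edges. It counts triples of a forest with `k = t +
1` components and two trees above it. The indicator of `m ≤ j` is at most this binomial, and falls
short of it by at most `n` times the binomial of `j` over `m + 1`. Hence the error is at most `n`
times the same sum for `k - 1` components, which turns out to be of lower order.

The triples are counted exactly. A forest with component sizes `a₁, …, aₖ` lies in `n ^ (k - 2) ∏
aᵢ` trees, and prescribed components carry `∏ aᵢ ^ (aᵢ - 2)` forests. Squaring the first and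
multiplying by the second leaves `n ^ (2k - 4) ∏ aᵢ ^ aᵢ`. Summed over partitions, this gives `n! /
k!` times a coefficient of the `k`-th power of `∑ a ^ a x ^ a / a!` over `a ≥ 1`. Both counts are
cases of `card_forestsAbove`.

After rescaling by `exp (-a)`, Stirling makes the coefficients asymptotic to `1 / √2` times those of
`(1 - x) ^ (-1/2)`, whose powers are explicit. The `k`-th power has coefficients of order `n ^ (k/2
- 1)`, so the normalized sum has order `n ^ (5(k - 1)/2)`. For `k = 2` the comparison series is `1 /
(1 - x)`, and the limiting constant follows. -/

/-! ### Classes of an equivalence relation on a finite type -/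

section Classes

variable {V : Type*} [Fintype V]

open scoped Classical in
/-- The equivalence class of `v`, as a finset. -/
noncomputable def Setoid.finsetClass (s : Setoid V) (v : V) : Finset V :=
  Finset.univ.filter fun w => s v w

open scoped Classical in
/-- The equivalence classes of a setoid on a finite type. -/
noncomputable def Setoid.finsetClasses (s : Setoid V) : Finset (Finset V) :=
  Finset.univ.image s.finsetClass

namespace Setoid

variable (s : Setoid V)

@[simp] lemma mem_finsetClass {v w : V} : w ∈ s.finsetClass v ↔ s v w := by
  simp [finsetClass]

lemma self_mem_finsetClass (v : V) : v ∈ s.finsetClass v := by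
  simp

lemma finsetClass_eq_iff {v w : V} : s.finsetClass v = s.finsetClass w ↔ s v w := by
  constructor
  · intro h
    rw [← mem_finsetClass, h]
    exact self_mem_finsetClass s w
  · intro h
    ext x
    simp only [mem_finsetClass]
    exact ⟨fun hx => s.trans (s.symm h) hx, fun hx => s.trans h hx⟩

lemma mem_finsetClasses {C : Finset V} : C ∈ s.finsetClasses ↔ ∃ v, s.finsetClass v = C := by
  simp [finsetClasses]

lemma finsetClass_mem (v : V) : s.finsetClass v ∈ s.finsetClasses :=
  s.mem_finsetClasses.2 ⟨v, rfl⟩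

lemma card_finsetClass_pos (v : V) : 0 < (s.finsetClass v).card :=
  Finset.card_pos.2 ⟨v, s.self_mem_finsetClass v⟩

open scoped Classical in
lemma filter_finsetClass_eq (v : V) :
    (Finset.univ.filter fun w => s.finsetClass w = s.finsetClass v) = s.finsetClass v := by
  ext w
  simp only [Finset.mem_filter, Finset.mem_univ, true_and, finsetClass_eq_iff, mem_finsetClass]
  exact ⟨fun h => s.symm h, fun h => s.symm h⟩

/-- A class `C` receives `1 / |C|` from each of its `|C|` elements, hence 1 in total. -/
lemma sum_inv_card_finsetClass :
    ∑ v, (1 / ((s.finsetClass v).card : ℝ)) = s.finsetClasses.card := by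
  classical
  rw [Finset.card_eq_sum_ones, Nat.cast_sum]
  symm
  unfold finsetClasses
  apply Finset.sum_image'
  intro v _
  rw [filter_finsetClass_eq, Finset.sum_congr rfl (g := fun _ => 1 / ((s.finsetClass v).card : ℝ))]
  · have := (s.card_finsetClass_pos v).ne'
    simp [this]
  · intro w hw
    rw [(s.finsetClass_eq_iff).2 ((s.mem_finsetClass).1 hw)]

lemma card_finsetClasses_eq : s.finsetClasses.card = Nat.card (Quotient s) := by
  classical
  rw [Nat.card_eq_fintype_card]
  have : Function.Injective (Quotient.lift s.finsetClass
      fun a b h => (s.finsetClass_eq_iff).2 h) := by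
    intro a b
    induction a using Quotient.inductionOn
    induction b using Quotient.inductionOn
    intro h
    exact Quotient.sound ((s.finsetClass_eq_iff).1 h)
  rw [← Finset.card_univ, ← Finset.card_image_of_injective _ this]
  congr 1
  ext C
  simp [mem_finsetClasses, Quotient.exists]

lemma le_finsetClass {r s : Setoid V} (h : r ≤ s) (v : V) : r.finsetClass v ⊆ s.finsetClass v := by
  intro w hw
  rw [mem_finsetClass] at *
  exact h hw

open scoped Classical in
lemma finsetClasses_bot : (⊥ : Setoid V).finsetClasses = Finset.univ.image fun v : V => {v} := by
  unfold finsetClasses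
  ext C
  simp only [Finset.mem_image]
  refine exists_congr fun v => and_congr_right fun _ => ?_
  have : (⊥ : Setoid V).finsetClass v = {v} := by
    ext w
    rw [mem_finsetClass, Finset.mem_singleton]
    exact eq_comm
  rw [this]

lemma finsetClasses_top [Nonempty V] : (⊤ : Setoid V).finsetClasses = {Finset.univ} := by
  classical
  ext C
  have (v : V) : (⊤ : Setoid V).finsetClass v = Finset.univ := by
    ext w
    rw [mem_finsetClass]
    simp [Setoid.top_def]
  simp [mem_finsetClasses, this, eq_comm]

end Setoid

end Classes

/-! ### Components of a graph and the effect of adding an edge -/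

namespace SimpleGraph

variable {V : Type*} {G : SimpleGraph V}

lemma reachable_sup_edge_iff {u v x y : V} (huv : u ≠ v) :
    (G ⊔ edge u v).Reachable x y ↔ G.Reachable x y ∨ (G.Reachable x u ∧ G.Reachable v y) ∨
      (G.Reachable x v ∧ G.Reachable u y) := by
  constructor
  · rintro ⟨p⟩
    induction p with
    | nil => exact Or.inl (Reachable.refl _)
    | cons h p ih =>
      rcases (sup_adj ..).1 h with h | h
      · have := h.reachable
        rcases ih with ih | ⟨ih, ih'⟩ | ⟨ih, ih'⟩
        · exact Or.inl (this.trans ih)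
        · exact Or.inr (Or.inl ⟨this.trans ih, ih'⟩)
        · exact Or.inr (Or.inr ⟨this.trans ih, ih'⟩)
      · rcases ((edge_adj ..).1 h).1 with ⟨rfl, rfl⟩ | ⟨rfl, rfl⟩
        · rcases ih with ih | ⟨ih, ih'⟩ | ⟨ih, ih'⟩
          · exact Or.inr (Or.inl ⟨Reachable.refl _, ih⟩)
          · exact Or.inr (Or.inl ⟨Reachable.refl _, ih'⟩)
          · exact Or.inl ih'
        · rcases ih with ih | ⟨ih, ih'⟩ | ⟨ih, ih'⟩
          · exact Or.inr (Or.inr ⟨Reachable.refl _, ih⟩)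
          · exact Or.inl ih'
          · exact Or.inr (Or.inr ⟨Reachable.refl _, ih'⟩)
  · have key : (G ⊔ edge u v).Reachable u v :=
      Adj.reachable ((sup_adj ..).2 (Or.inr ((edge_adj ..).2 ⟨Or.inl ⟨rfl, rfl⟩, huv⟩)))
    have mono {a b : V} (h : G.Reachable a b) : (G ⊔ edge u v).Reachable a b := h.mono le_sup_left
    rintro (h | ⟨h, h'⟩ | ⟨h, h'⟩)
    · exact mono h
    · exact (mono h).trans (key.trans (mono h'))
    · exact (mono h).trans (key.symm.trans (mono h'))

/-- Every edge of a forest is a bridge, so a connection inside the subgraph has to use the edge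
itself. -/
lemma IsAcyclic.adj_of_reachable {F : SimpleGraph V} (hF : F.IsAcyclic) (h : G ≤ F) {u v : V}
    (huv : F.Adj u v) (hr : G.Reachable u v) : G.Adj u v :=
  (IsBridge.anti h (isAcyclic_iff_forall_adj_isBridge.1 hF huv)).reachable_iff_adj.1 hr

lemma reachableSetoid_apply {u v : V} : G.reachableSetoid u v ↔ G.Reachable u v := Iff.rfl

lemma reachableSetoid_bot : (⊥ : SimpleGraph V).reachableSetoid = ⊥ := by
  ext u v
  rw [reachableSetoid_apply, reachable_bot]
  rfl

variable [Fintype V]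

open scoped Classical in
/-- Joining two components by an edge merges two of the reachability classes. -/
lemma exists_finsetClasses_sup_edge {u v : V} (h : ¬ G.Reachable u v) :
    ∃ R : Finset (Finset V),
      G.reachableSetoid.finsetClass u ∉ insert (G.reachableSetoid.finsetClass v) R ∧
      G.reachableSetoid.finsetClass v ∉ R ∧
      G.reachableSetoid.finsetClass u ∪ G.reachableSetoid.finsetClass v ∉ R ∧
      G.reachableSetoid.finsetClasses = insert (G.reachableSetoid.finsetClass u)
        (insert (G.reachableSetoid.finsetClass v) R) ∧
      (G ⊔ edge u v).reachableSetoid.finsetClasses =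
        insert (G.reachableSetoid.finsetClass u ∪ G.reachableSetoid.finsetClass v) R := by
  have huv : u ≠ v := by rintro rfl; exact h (Reachable.refl _)
  set r := G.reachableSetoid with hr
  -- The classes untouched by the new edge are those containing neither endpoint.
  refine ⟨r.finsetClasses.filter fun C => u ∉ C ∧ v ∉ C, ?_, ?_, ?_, ?_, ?_⟩
  · rw [Finset.mem_insert, not_or, r.finsetClass_eq_iff]
    refine ⟨h, fun hm => ?_⟩
    exact (Finset.mem_filter.1 hm).2.1 (r.self_mem_finsetClass u)
  · intro hm
    exact (Finset.mem_filter.1 hm).2.2 (r.self_mem_finsetClass v)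
  · intro hm
    exact (Finset.mem_filter.1 hm).2.1 (Finset.mem_union_left _ (r.self_mem_finsetClass u))
  · ext C
    simp only [Finset.mem_insert, Finset.mem_filter]
    constructor
    · intro hC
      obtain ⟨w, rfl⟩ := r.mem_finsetClasses.1 hC
      by_cases hu : r w u
      · exact Or.inl ((r.finsetClass_eq_iff).2 hu)
      by_cases hv : r w v
      · exact Or.inr (Or.inl ((r.finsetClass_eq_iff).2 hv))
      exact Or.inr (Or.inr ⟨hC, by simpa using hu, by simpa using hv⟩)
    · rintro (rfl | rfl | ⟨h, -⟩)
      · exact r.finsetClass_mem u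
      · exact r.finsetClass_mem v
      · exact h
  · have hout (w : V) (hu : ¬ r w u) (hv : ¬ r w v) :
        (G ⊔ edge u v).reachableSetoid.finsetClass w = r.finsetClass w := by
      ext x
      rw [Setoid.mem_finsetClass, Setoid.mem_finsetClass, reachableSetoid_apply,
        reachable_sup_edge_iff huv]
      rw [hr, reachableSetoid_apply] at hu hv
      rw [hr, reachableSetoid_apply]
      tauto
    have hu : (G ⊔ edge u v).reachableSetoid.finsetClass u = r.finsetClass u ∪ r.finsetClass v := by
      ext x
      rw [Finset.mem_union, Setoid.mem_finsetClass, Setoid.mem_finsetClass, Setoid.mem_finsetClass,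
        reachableSetoid_apply, reachable_sup_edge_iff huv, hr, reachableSetoid_apply,
        reachableSetoid_apply]
      have := Reachable.refl (G := G) u
      tauto
    ext C
    simp only [Finset.mem_insert, Finset.mem_filter]
    constructor
    · intro hC
      obtain ⟨w, rfl⟩ := (Setoid.mem_finsetClasses _).1 hC
      by_cases hw : r w u ∨ r w v
      · left
        rw [← hu, Setoid.finsetClass_eq_iff, reachableSetoid_apply, reachable_sup_edge_iff huv]
        have := Reachable.refl (G := G) u
        rw [hr, reachableSetoid_apply, reachableSetoid_apply] at hw
        tauto
      · rw [not_or] at hw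
        right
        rw [hout w hw.1 hw.2]
        exact ⟨r.finsetClass_mem w, by simpa using hw.1, by simpa using hw.2⟩
    · rintro (rfl | ⟨hC, h1, h2⟩)
      · rw [← hu]
        exact Setoid.finsetClass_mem _ _
      · obtain ⟨w, rfl⟩ := (Setoid.mem_finsetClasses _).1 hC
        rw [← hout w (by simpa using h1) (by simpa using h2)]
        exact Setoid.finsetClass_mem _ _

lemma card_finsetClasses_sup_edge {u v : V} (h : ¬ G.Reachable u v) :
    (G ⊔ edge u v).reachableSetoid.finsetClasses.card + 1 =
      G.reachableSetoid.finsetClasses.card := by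
  classical
  obtain ⟨R, h1, h2, h3, h4, h5⟩ := exists_finsetClasses_sup_edge h
  rw [h4, h5, Finset.card_insert_of_notMem h1, Finset.card_insert_of_notMem h2,
    Finset.card_insert_of_notMem h3]

open scoped Classical in
-- Two factors are replaced by one; the cross-multiplied form needs no nonvanishing of `f`.
lemma prod_finsetClasses_sup_edge {u v : V} (h : ¬ G.Reachable u v) (f : Finset V → ℝ) :
    (∏ C ∈ (G ⊔ edge u v).reachableSetoid.finsetClasses, f C) *
      (f (G.reachableSetoid.finsetClass u) * f (G.reachableSetoid.finsetClass v)) =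
    (∏ C ∈ G.reachableSetoid.finsetClasses, f C) *
      f (G.reachableSetoid.finsetClass u ∪ G.reachableSetoid.finsetClass v) := by
  obtain ⟨R, h1, h2, h3, h4, h5⟩ := exists_finsetClasses_sup_edge h
  rw [h4, h5, Finset.prod_insert h1, Finset.prod_insert h2, Finset.prod_insert h3]
  ring

/-- Deleting an edge of a forest, which is a bridge, splits one component into two. -/
lemma IsAcyclic.ncard_edgeSet_add (hG : G.IsAcyclic) :
    G.edgeSet.ncard + G.reachableSetoid.finsetClasses.card = Fintype.card V := by
  classical
  induction hm : G.edgeSet.ncard generalizing G with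
  | zero =>
    have : G = ⊥ := by
      rw [Set.ncard_eq_zero] at hm
      exact edgeSet_eq_empty.1 hm
    subst this
    rw [reachableSetoid_bot, Setoid.finsetClasses_bot,
      Finset.card_image_of_injective _ Finset.singleton_injective]
    simp
  | succ m ih =>
    obtain ⟨e, he⟩ : G.edgeSet.Nonempty := by
      rw [← Set.ncard_pos]
      omega
    induction e with | _ u v => ?_
    have hadj : G.Adj u v := he
    set H := G.deleteEdges {s(u, v)} with hH
    have hHG : H ≤ G := deleteEdges_le _
    have hnr : ¬ H.Reachable u v := isAcyclic_iff_forall_adj_isBridge.1 hG hadj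
    have hG' : H ⊔ edge u v = G := by
      rw [hH, edge, deleteEdges]
      apply sdiff_sup_cancel
      rw [← edge, edge_le_iff]
      exact Or.inr hadj
    have hcard : H.edgeSet.ncard = m := by
      rw [hH, edgeSet_deleteEdges, Set.ncard_sdiff_singleton_of_mem he]
      omega
    have := ih (hG.anti hHG) hcard
    have h2 := card_finsetClasses_sup_edge hnr
    rw [hG'] at h2
    omega

end SimpleGraph

/-! ### Counting forests with given components above a given forest -/

namespace SimpleGraph

variable {V : Type*}

lemma reachableSetoid_sup_edge_le {G : SimpleGraph V} {s : Setoid V} (h : G.reachableSetoid ≤ s)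
    {u v : V} (huv : s u v) (hne : u ≠ v) : (G ⊔ edge u v).reachableSetoid ≤ s := by
  intro x y hxy
  rcases (reachable_sup_edge_iff hne).1 hxy with h' | ⟨h1, h2⟩ | ⟨h1, h2⟩
  · exact h h'
  · exact s.trans (h h1) (s.trans huv (h h2))
  · exact s.trans (h h1) (s.trans (s.symm huv) (h h2))

variable [Fintype V]

open scoped Classical in
lemma card_filter_adj (G : SimpleGraph V) :
    (Finset.univ.filter fun p : V × V => G.Adj p.1 p.2).card = 2 * G.edgeSet.ncard := by
  rw [Set.ncard_eq_toFinset_card', ← edgeFinset, ← sum_degrees_eq_twice_card_edges,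
    Finset.card_filter, Fintype.sum_prod_type]
  refine Finset.sum_congr rfl fun v _ => ?_
  rw [← Finset.card_filter, ← card_neighborFinset_eq_degree, neighborFinset_eq_filter]

open scoped Classical in
/-- The forests that contain `G` and whose components are the classes of `s`. -/
noncomputable def forestsAbove (G : SimpleGraph V) (s : Setoid V) : Finset (SimpleGraph V) :=
  Finset.univ.filter fun F => G ≤ F ∧ F.IsAcyclic ∧ F.reachableSetoid = s

lemma mem_forestsAbove {G F : SimpleGraph V} {s : Setoid V} :
    F ∈ G.forestsAbove s ↔ G ≤ F ∧ F.IsAcyclic ∧ F.reachableSetoid = s := by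
  simp [forestsAbove]

open scoped Classical in
-- An edge of `F` lies in `G` or joins two components of `G`, and edge numbers are read off from
-- component numbers. Pairs are ordered, whence the factors 2.
lemma card_new_pairs {G F : SimpleGraph V} {s : Setoid V} (hF : F ∈ G.forestsAbove s) :
    (Finset.univ.filter fun p : V × V =>
      (s p.1 p.2 ∧ ¬ G.Reachable p.1 p.2) ∧ F.Adj p.1 p.2).card + 2 * s.finsetClasses.card =
      2 * G.reachableSetoid.finsetClasses.card := by
  obtain ⟨hGF, hac, rfl⟩ := mem_forestsAbove.1 hF
  have h1 := hac.ncard_edgeSet_add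
  have h2 := (hac.anti hGF).ncard_edgeSet_add
  have h3 : (Finset.univ.filter fun p : V × V =>
      (F.reachableSetoid p.1 p.2 ∧ ¬ G.Reachable p.1 p.2) ∧ F.Adj p.1 p.2).card +
      (Finset.univ.filter fun p : V × V => G.Adj p.1 p.2).card =
      (Finset.univ.filter fun p : V × V => F.Adj p.1 p.2).card := by
    rw [← Finset.card_union_of_disjoint]
    · congr 1
      ext p
      simp only [Finset.mem_union, Finset.mem_filter, Finset.mem_univ, true_and]
      constructor
      · rintro (h | h)
        · exact h.2
        · exact hGF h
      · intro h
        by_cases hr : G.Reachable p.1 p.2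
        · exact Or.inr (hac.adj_of_reachable hGF h hr)
        · exact Or.inl ⟨⟨h.reachable, hr⟩, h⟩
    · rw [Finset.disjoint_filter]
      exact fun p _ h h' => h.1.2 h'.reachable
  rw [card_filter_adj, card_filter_adj] at h3
  omega

open scoped Classical in
-- Double counting of a forest together with one of its new edges, taken as an ordered pair. This is
-- the recursion behind `card_forestsAbove`.
lemma sum_card_forestsAbove_sup_edge (G : SimpleGraph V) (s : Setoid V) :
    ∑ p ∈ Finset.univ.filter (fun p : V × V => s p.1 p.2 ∧ ¬ G.Reachable p.1 p.2),
      ((G ⊔ edge p.1 p.2).forestsAbove s).card + 2 * s.finsetClasses.card * (G.forestsAbove s).card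
      = 2 * G.reachableSetoid.finsetClasses.card * (G.forestsAbove s).card := by
  have h := Finset.sum_card_bipartiteAbove_eq_sum_card_bipartiteBelow
    (s := Finset.univ.filter (fun p : V × V => s p.1 p.2 ∧ ¬ G.Reachable p.1 p.2))
    (t := G.forestsAbove s) (fun p F => F.Adj p.1 p.2)
  have h1 : ∀ p ∈ Finset.univ.filter (fun p : V × V => s p.1 p.2 ∧ ¬ G.Reachable p.1 p.2),
      Finset.bipartiteAbove (fun (p : V × V) (F : SimpleGraph V) => F.Adj p.1 p.2)
        (G.forestsAbove s) p = (G ⊔ edge p.1 p.2).forestsAbove s := by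
    intro p hp
    have hne : p.1 ≠ p.2 := by
      intro he
      apply (Finset.mem_filter.1 hp).2.2
      rw [he]
    ext F
    rw [Finset.mem_bipartiteAbove, mem_forestsAbove, mem_forestsAbove, sup_le_iff, edge_le_iff]
    tauto
  rw [← Finset.sum_congr rfl fun p hp => congrArg Finset.card (h1 p hp), h, mul_comm (2 * _),
    mul_comm (2 * _), ← smul_eq_mul (G.forestsAbove s).card,
    ← smul_eq_mul (G.forestsAbove s).card, ← Finset.sum_const, ← Finset.sum_const,
    ← Finset.sum_add_distrib]
  refine Finset.sum_congr rfl fun F hF => ?_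
  rw [← card_new_pairs hF, Finset.bipartiteBelow, Finset.filter_filter]

open scoped Classical in
-- Fix `u` with `r`-class of size `a` and `s`-class of size `c`. It has `c - a` partners,
-- contributing `(c - a) / (a c) = 1/a - 1/c`, and reciprocal class sizes sum to the number of
-- classes. The other summand is symmetric.
lemma _root_.Setoid.sum_pairs_inv_card {r s : Setoid V} (h : r ≤ s) :
    ∑ p ∈ Finset.univ.filter (fun p : V × V => s p.1 p.2 ∧ ¬ r p.1 p.2),
      (1 / ((r.finsetClass p.1).card : ℝ) + 1 / (r.finsetClass p.2).card) /
        (s.finsetClass p.1).card =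
      2 * (r.finsetClasses.card - s.finsetClasses.card) := by
  have key : ∑ p ∈ Finset.univ.filter (fun p : V × V => s p.1 p.2 ∧ ¬ r p.1 p.2),
      (1 / ((r.finsetClass p.1).card : ℝ)) / (s.finsetClass p.1).card =
      r.finsetClasses.card - s.finsetClasses.card := by
    rw [← r.sum_inv_card_finsetClass, ← s.sum_inv_card_finsetClass, ← Finset.sum_sub_distrib,
      Finset.sum_filter, Fintype.sum_prod_type]
    refine Finset.sum_congr rfl fun u _ => ?_
    dsimp only
    rw [← Finset.sum_filter, Finset.sum_const,
      show (Finset.univ.filter fun v => s u v ∧ ¬ r u v) = s.finsetClass u \ r.finsetClass u by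
        ext; simp, Finset.card_sdiff_of_subset (Setoid.le_finsetClass h u), nsmul_eq_mul,
      Nat.cast_sub (Finset.card_le_card (Setoid.le_finsetClass h u))]
    have h1 : ((r.finsetClass u).card : ℝ) ≠ 0 := by exact_mod_cast (r.card_finsetClass_pos u).ne'
    have h2 : ((s.finsetClass u).card : ℝ) ≠ 0 := by exact_mod_cast (s.card_finsetClass_pos u).ne'
    field_simp
  have key' : ∑ p ∈ Finset.univ.filter (fun p : V × V => s p.1 p.2 ∧ ¬ r p.1 p.2),
      (1 / ((r.finsetClass p.2).card : ℝ)) / (s.finsetClass p.1).card =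
      r.finsetClasses.card - s.finsetClasses.card := by
    rw [← key]
    refine Finset.sum_bij' (fun p _ => p.swap) (fun p _ => p.swap) ?_ ?_ ?_ ?_ ?_
    · intro p hp
      simp only [Finset.mem_filter, Finset.mem_univ, true_and, Prod.fst_swap, Prod.snd_swap] at *
      exact ⟨s.symm hp.1, fun h' => hp.2 (r.symm h')⟩
    · intro p hp
      simp only [Finset.mem_filter, Finset.mem_univ, true_and, Prod.fst_swap, Prod.snd_swap] at *
      exact ⟨s.symm hp.1, fun h' => hp.2 (r.symm h')⟩
    · simp
    · simp
    · intro p hp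
      simp only [Finset.mem_filter, Finset.mem_univ, true_and] at hp
      rw [Prod.fst_swap, (s.finsetClass_eq_iff).2 hp.1]
  simp_rw [add_div]
  rw [Finset.sum_add_distrib, key, key']
  ring

open scoped Classical in
/-- The number of elements that are `s`-equivalent to an element of `C`. -/
noncomputable def _root_.Setoid.saturationCard (s : Setoid V) (C : Finset V) : ℕ :=
  (Finset.univ.filter fun w => ∃ v ∈ C, s v w).card

lemma _root_.Setoid.saturationCard_finsetClass {r s : Setoid V} (h : r ≤ s) (v : V) :
    s.saturationCard (r.finsetClass v) = (s.finsetClass v).card := by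
  unfold Setoid.saturationCard
  congr 1
  ext w
  simp only [Finset.mem_filter, Finset.mem_univ, true_and, Setoid.mem_finsetClass]
  exact ⟨fun ⟨x, hx, hw⟩ => s.trans (h hx) hw, fun hw => ⟨v, r.refl v, hw⟩⟩

open scoped Classical in
lemma _root_.Setoid.saturationCard_union {r s : Setoid V} (h : r ≤ s) {u v : V} (huv : s u v) :
    s.saturationCard (r.finsetClass u ∪ r.finsetClass v) = (s.finsetClass u).card := by
  unfold Setoid.saturationCard
  congr 1
  ext w
  simp only [Finset.mem_filter, Finset.mem_univ, true_and, Setoid.mem_finsetClass, Finset.mem_union]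
  constructor
  · rintro ⟨x, hx | hx, hw⟩
    · exact s.trans (h hx) hw
    · exact s.trans huv (s.trans (h hx) hw)
  · exact fun hw => ⟨u, Or.inl (r.refl u), hw⟩

lemma forestsAbove_of_reachableSetoid_eq {G : SimpleGraph V} (hG : G.IsAcyclic) :
    G.forestsAbove G.reachableSetoid = {G} := by
  ext F
  rw [mem_forestsAbove, Finset.mem_singleton]
  constructor
  · rintro ⟨h1, h2, h3⟩
    refine le_antisymm (fun u v huv => h2.adj_of_reachable h1 huv ?_) h1
    rw [← reachableSetoid_apply, ← h3]
    exact huv.reachable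
  · rintro rfl
    exact ⟨le_rfl, hG, rfl⟩

/-- The number of forests with prescribed components that contain a given forest. -/
theorem card_forestsAbove {G : SimpleGraph V} (hG : G.IsAcyclic) {s : Setoid V}
    (h : G.reachableSetoid ≤ s) :
    ((G.forestsAbove s).card : ℝ) * ∏ B ∈ s.finsetClasses, (B.card : ℝ) ^ 2 =
      ∏ C ∈ G.reachableSetoid.finsetClasses, (C.card : ℝ) * s.saturationCard C := by
  classical
  -- Each added edge lowers the number of components by one. The claimed formula is shown to satisfy
  -- the same recursion as the count.
  induction hk : G.reachableSetoid.finsetClasses.card using Nat.strong_induction_on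
    generalizing G with
  | _ k ih =>
  by_cases hrs : ∀ u v, s u v → G.Reachable u v
  · have : s = G.reachableSetoid := le_antisymm (fun u v huv => hrs u v huv) h
    subst this
    rw [forestsAbove_of_reachableSetoid_eq hG, Finset.card_singleton, Nat.cast_one, one_mul]
    refine Finset.prod_congr rfl fun C hC => ?_
    obtain ⟨v, rfl⟩ := (Setoid.mem_finsetClasses _).1 hC
    rw [Setoid.saturationCard_finsetClass le_rfl, sq]
  · push Not at hrs
    obtain ⟨u₀, v₀, hs₀, hr₀⟩ := hrs
    set S := Finset.univ.filter (fun p : V × V => s p.1 p.2 ∧ ¬ G.Reachable p.1 p.2) with hS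
    set D := ∏ B ∈ s.finsetClasses, (B.card : ℝ) ^ 2
    set r := G.reachableSetoid with hr
    set W := ∏ C ∈ r.finsetClasses, (C.card : ℝ) * s.saturationCard C with hW
    have hrec := sum_card_forestsAbove_sup_edge G s
    have hpairs := Setoid.sum_pairs_inv_card h
    rw [← hr, ← hS] at hrec
    rw [show (Finset.univ.filter fun p : V × V => s p.1 p.2 ∧ ¬ r p.1 p.2) = S by
      ext p; simp only [hS, Finset.mem_filter, reachableSetoid_apply]] at hpairs
    have ha (v : V) : (0 : ℝ) < (r.finsetClass v).card := by
      exact_mod_cast r.card_finsetClass_pos v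
    have hb (v : V) : (0 : ℝ) < (s.finsetClass v).card := by
      exact_mod_cast s.card_finsetClass_pos v
    -- The pair `(u₀, v₀)` makes the sum strictly positive; this licenses the final cancellation.
    have hpos : 0 < (r.finsetClasses.card - s.finsetClasses.card : ℝ) := by
      have : 0 < ∑ p ∈ S, (1 / ((r.finsetClass p.1).card : ℝ) + 1 / (r.finsetClass p.2).card) /
          (s.finsetClass p.1).card := by
        refine Finset.sum_pos (fun p _ => ?_) ⟨(u₀, v₀), by simp [hS, hs₀, hr₀]⟩
        have := ha p.1
        have := ha p.2
        have := hb p.1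
        positivity
      linarith
    -- Merging classes of sizes `a` and `b` in a block of size `c` replaces the factors `a c` and `b
    -- c` by `(a + b) c`, a ratio of `(1/a + 1/b) / c`.
    have hstep : ∀ p ∈ S, (((G ⊔ edge p.1 p.2).forestsAbove s).card : ℝ) * D =
        W * ((1 / ((r.finsetClass p.1).card : ℝ) + 1 / (r.finsetClass p.2).card) /
          (s.finsetClass p.1).card) := by
      rintro ⟨u, v⟩ hp
      obtain ⟨hs, hnr⟩ := (Finset.mem_filter.1 hp).2
      dsimp only at hs hnr ⊢
      have hne : u ≠ v := by rintro rfl; exact hnr (Reachable.refl _)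
      have hlt := card_finsetClasses_sup_edge hnr
      rw [← hr] at hlt
      rw [ih _ (by omega) (hG.sup_edge_of_not_reachable hnr)
        (reachableSetoid_sup_edge_le h hs hne) rfl]
      have hprod := prod_finsetClasses_sup_edge hnr
        (fun C => (C.card : ℝ) * s.saturationCard C)
      rw [← hr, ← hW, Setoid.saturationCard_union h hs, Setoid.saturationCard_finsetClass h,
        Setoid.saturationCard_finsetClass h, ← (s.finsetClass_eq_iff).2 hs,
        Finset.card_union_of_disjoint, Nat.cast_add] at hprod
      · have h1 := ha u
        have h2 := ha v
        have h3 := hb u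
        field_simp
        rw [← mul_right_cancel_iff_of_pos h3]
        linear_combination hprod
      · rw [Finset.disjoint_left]
        intro x hx hx'
        rw [Setoid.mem_finsetClass] at hx hx'
        exact hnr (r.trans hx (r.symm hx'))
    have hrec' : (∑ p ∈ S, (((G ⊔ edge p.1 p.2).forestsAbove s).card : ℝ)) =
        2 * (r.finsetClasses.card - s.finsetClasses.card) * (G.forestsAbove s).card := by
      have : (∑ p ∈ S, (((G ⊔ edge p.1 p.2).forestsAbove s).card : ℝ)) +
        2 * s.finsetClasses.card * (G.forestsAbove s).card =
          2 * r.finsetClasses.card * (G.forestsAbove s).card := by exact_mod_cast hrec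
      linarith
    have hsum : (∑ p ∈ S, (((G ⊔ edge p.1 p.2).forestsAbove s).card : ℝ)) * D =
        W * (2 * (r.finsetClasses.card - s.finsetClasses.card)) := by
      rw [← hpairs, Finset.sum_mul, Finset.mul_sum]
      exact Finset.sum_congr rfl hstep
    rw [hrec'] at hsum
    have h0 : (2 * (r.finsetClasses.card - s.finsetClasses.card) : ℝ) ≠ 0 := by positivity
    apply mul_left_cancel₀ h0
    linarith

/-- The number of trees that contain a given forest. -/
theorem card_trees_above [Nonempty V] {G : SimpleGraph V} (hG : G.IsAcyclic) :
    ((G.forestsAbove ⊤).card : ℝ) * (Fintype.card V : ℝ) ^ 2 =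
      (Fintype.card V : ℝ) ^ G.reachableSetoid.finsetClasses.card *
        ∏ C ∈ G.reachableSetoid.finsetClasses, (C.card : ℝ) := by
  have h := card_forestsAbove hG (le_top : G.reachableSetoid ≤ ⊤)
  rw [Setoid.finsetClasses_top, Finset.prod_singleton, Finset.card_univ] at h
  rw [h, Finset.prod_mul_distrib, mul_comm]
  congr 1
  rw [← Finset.prod_const]
  refine Finset.prod_congr rfl fun C hC => ?_
  obtain ⟨v, rfl⟩ := (Setoid.mem_finsetClasses _).1 hC
  rw [Setoid.saturationCard_finsetClass le_top]
  norm_cast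
  rw [← Finset.card_univ]
  congr 1
  ext w
  simp [Setoid.top_def]

/-- The number of forests with prescribed components. -/
theorem card_forestsAbove_bot (s : Setoid V) :
    (((⊥ : SimpleGraph V).forestsAbove s).card : ℝ) * ∏ B ∈ s.finsetClasses, (B.card : ℝ) ^ 2 =
      ∏ v, ((s.finsetClass v).card : ℝ) := by
  classical
  rw [card_forestsAbove isAcyclic_bot (by rw [reachableSetoid_bot]; exact bot_le),
    reachableSetoid_bot, Setoid.finsetClasses_bot,
    Finset.prod_image (fun _ _ _ _ h => Finset.singleton_injective h)]
  refine Finset.prod_congr rfl fun v _ => ?_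
  rw [Finset.card_singleton, Nat.cast_one, one_mul]
  unfold Setoid.saturationCard
  congr 2
  ext w
  simp

end SimpleGraph

/-! ### Colourings and exponential generating functions -/

section Colorings

open scoped Nat

open scoped Classical in
/-- Summing a multiplicative weight of the colour class sizes over all colourings. -/
lemma sum_prod_card_fiber (w : ℕ → ℝ) (n k : ℕ) :
    ∑ q : Fin n → Fin k, ∏ i, w (Finset.univ.filter fun v => q v = i).card =
      n ! * PowerSeries.coeff n ((PowerSeries.mk fun a => w a / a !) ^ k) := by
  -- This functional replaces a monomial by the weight of its exponents. It is applied to `(∑ Xᵢ) ^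
  -- n` expanded once over colourings and once by the multinomial theorem.
  set L : MvPolynomial (Fin k) ℝ →ₗ[ℝ] ℝ :=
    (MvPolynomial.basisMonomials (Fin k) ℝ).constr ℝ fun m => ∏ i, w (m i) with hL
  have hLm (m : Fin k →₀ ℕ) : L (MvPolynomial.monomial m 1) = ∏ i, w (m i) := by
    have := (MvPolynomial.basisMonomials (Fin k) ℝ).constr_basis ℝ (fun m => ∏ i, w (m i)) m
    rwa [MvPolynomial.coe_basisMonomials] at this
  have h1 (q : Fin n → Fin k) : L (∏ v, MvPolynomial.X (q v)) =
      ∏ i, w (Finset.univ.filter fun v => q v = i).card := by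
    have : (∏ v, (MvPolynomial.X (q v) : MvPolynomial (Fin k) ℝ)) =
        MvPolynomial.monomial (∑ v, Finsupp.single (q v) 1) 1 := by
      rw [MvPolynomial.monomial_sum_one]
      rfl
    rw [this, hLm]
    refine Finset.prod_congr rfl fun i _ => ?_
    congr 1
    rw [Finsupp.finsetSum_apply, Finset.card_filter]
    exact Finset.sum_congr rfl fun v _ => by rw [Finsupp.single_apply]
  have h2 := congrArg L (Fintype.sum_pow (fun i : Fin k => (MvPolynomial.X i :
    MvPolynomial (Fin k) ℝ)) n)
  rw [map_sum] at h2
  rw [← Finset.sum_congr rfl fun q _ => h1 q, ← h2, Finset.sum_pow_eq_sum_piAntidiag, map_sum]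
  have h3 : PowerSeries.coeff n ((PowerSeries.mk fun a => w a / (a ! : ℝ)) ^ k) =
      ∑ m ∈ Finset.piAntidiag (Finset.univ : Finset (Fin k)) n, ∏ i, (w (m i) / (m i)!) := by
    have := PowerSeries.coeff_prod (fun _ : Fin k => PowerSeries.mk fun a => w a / (a ! : ℝ)) n
      Finset.univ
    rw [Finset.prod_const, Finset.card_univ, Fintype.card_fin] at this
    rw [this]
    refine Finset.sum_bij' (fun l _ => (l : Fin k → ℕ))
      (fun m _ => Finsupp.equivFunOnFinite.symm m) ?_ ?_ ?_ ?_ ?_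
    · intro l hl
      simpa using (Finset.mem_finsuppAntidiag.1 hl).1
    · intro m hm
      simpa using hm
    · intro l _
      ext; simp
    · intro m _
      ext; simp
    · intro l _
      simp
  rw [h3, Finset.mul_sum]
  refine Finset.sum_congr rfl fun m hm => ?_
  have hm' : ∑ i, m i = n := (Finset.mem_piAntidiag.1 hm).1
  have h4 : (∏ i, (MvPolynomial.X i : MvPolynomial (Fin k) ℝ) ^ m i) =
      MvPolynomial.monomial (Finsupp.equivFunOnFinite.symm m) 1 := by
    rw [MvPolynomial.monomial_eq, map_one, one_mul, Finsupp.prod_fintype _ _ fun i => pow_zero _]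
    rfl
  have h5 := Nat.multinomial_spec Finset.univ m
  rw [hm'] at h5
  rw [h4, ← nsmul_eq_mul, map_nsmul, hLm, nsmul_eq_mul, Finset.prod_div_distrib, ← h5]
  have h6 : (∏ i, ((m i)! : ℝ)) ≠ 0 :=
    Finset.prod_ne_zero_iff.2 fun i _ => by exact_mod_cast (Nat.factorial_pos _).ne'
  push_cast
  simp only [Finsupp.equivFunOnFinite_symm_apply_apply]
  field_simp

/-- The coefficients `a ^ a * exp (-a) / a!`, without the one at `0`. -/
noncomputable def selfMapSeq (a : ℕ) : ℝ :=
  if a = 0 then 0 else (a : ℝ) ^ a * Real.exp (-a) / (a ! : ℝ)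

open scoped Classical in
-- A colour class of size `a` contributes `a ^ a`. The zero coefficient at `a = 0` discards
-- colourings that miss a colour, and the factors `exp (-a)` multiply to `exp (-n)`.
lemma sum_surjective_prod_card (n k : ℕ) :
    ∑ q ∈ Finset.univ.filter (fun q : Fin n → Fin k => Function.Surjective q),
      ∏ v, ((Finset.univ.filter fun w => q w = q v).card : ℝ) =
      Real.exp n * n ! * PowerSeries.coeff n (PowerSeries.mk selfMapSeq ^ k) := by
  have h := sum_prod_card_fiber
    (fun a => if a = 0 then 0 else (a : ℝ) ^ a * Real.exp (-a)) n k
  have hs : (PowerSeries.mk fun a => (if a = 0 then 0 else (a : ℝ) ^ a * Real.exp (-a)) / (a ! : ℝ))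
      = PowerSeries.mk selfMapSeq := by
    ext a
    simp only [PowerSeries.coeff_mk, selfMapSeq]
    split_ifs <;> simp
  rw [hs] at h
  rw [mul_assoc, ← h, Finset.mul_sum, Finset.sum_filter]
  refine Finset.sum_congr rfl fun q _ => ?_
  split_ifs with hq
  · have hne (i : Fin k) : (Finset.univ.filter fun v => q v = i).card ≠ 0 := by
      obtain ⟨v, hv⟩ := hq i
      exact Finset.card_ne_zero.2 ⟨v, by simpa using hv⟩
    simp only [hne, if_false]
    rw [Finset.prod_mul_distrib, ← Real.exp_sum, Finset.sum_neg_distrib, ← Nat.cast_sum,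
      ← Finset.card_eq_sum_card_fiberwise (fun _ _ => Finset.mem_coe.2 (Finset.mem_univ _)),
      Finset.card_univ, Fintype.card_fin, mul_left_comm, ← Real.exp_add, add_neg_cancel,
      Real.exp_zero, mul_one, ← Finset.prod_fiberwise (s := Finset.univ) (g := q)]
    refine Finset.prod_congr rfl fun i _ => ?_
    rw [Finset.prod_congr rfl
      (g := fun _ => ((Finset.univ.filter fun v => q v = i).card : ℝ)), Finset.prod_const]
    intro v hv
    rw [(Finset.mem_filter.1 hv).2]
  · simp only [Function.Surjective, not_forall, not_exists] at hq
    obtain ⟨i, hi⟩ := hq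
    rw [Finset.prod_eq_zero (Finset.mem_univ i), mul_zero]
    rw [if_pos]
    rw [Finset.card_eq_zero, Finset.filter_eq_empty_iff]
    exact fun v _ => hi v

open scoped Classical in
-- Such surjections are the bijections from the quotient to `Fin k`.
lemma card_surjective_ker_eq {V : Type*} [Fintype V] (s : Setoid V) {k : ℕ}
    (hk : s.finsetClasses.card = k) :
    (Finset.univ.filter fun q : V → Fin k => Function.Surjective q ∧ Setoid.ker q = s).card =
      k ! := by
  rw [Setoid.card_finsetClasses_eq, Nat.card_eq_fintype_card] at hk
  let e₀ : Quotient s ≃ Fin k := Fintype.equivFinOfCardEq hk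
  have e : {q : V → Fin k // Function.Surjective q ∧ Setoid.ker q = s} ≃ (Quotient s ≃ Fin k) :=
    { toFun := fun q => Equiv.ofBijective
        (Quotient.lift q.1 fun a b h => by
          have h' : Setoid.ker q.1 a b := by rw [q.2.2]; exact h
          exact h') ⟨by
            intro a b
            induction a using Quotient.inductionOn
            induction b using Quotient.inductionOn
            intro h
            apply Quotient.sound
            have h' : Setoid.ker q.1 _ _ := h
            rw [q.2.2] at h'
            exact h', fun i => by
            obtain ⟨v, hv⟩ := q.2.1 i
            exact ⟨Quotient.mk s v, hv⟩⟩
      invFun := fun f => ⟨fun v => f (Quotient.mk s v),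
        f.surjective.comp Quotient.mk_surjective, by
          ext a b
          rw [Setoid.ker_def, f.apply_eq_iff_eq, Quotient.eq]⟩
      left_inv := fun q => rfl
      right_inv := fun f => by
        ext x
        induction x using Quotient.inductionOn
        rfl }
  rw [← Fintype.card_subtype, Fintype.card_congr e, Fintype.card_equiv e₀,
    hk]

end Colorings

/-! ### Summing over all forests with a given number of components -/

namespace SimpleGraph

open scoped Nat

open scoped Classical in
/-- The forests with exactly `k` components. -/
noncomputable def forestsWith (V : Type*) [Fintype V] (k : ℕ) : Finset (SimpleGraph V) :=
  Finset.univ.filter fun F => F.IsAcyclic ∧ F.reachableSetoid.finsetClasses.card = k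

lemma mem_forestsWith {V : Type*} [Fintype V] {k : ℕ} {F : SimpleGraph V} :
    F ∈ forestsWith V k ↔ F.IsAcyclic ∧ F.reachableSetoid.finsetClasses.card = k := by
  simp [forestsWith]

open scoped Classical in
-- The factor `k!` labels the components, turning forests into pairs of a surjection and a forest on
-- its fibres. By `card_forestsAbove_bot`, the squared sizes cancel the denominators in the number
-- of forests on the fibres.
lemma sum_forestsWith (n k : ℕ) :
    k ! * ∑ F ∈ forestsWith (Fin n) k,
      (∏ C ∈ F.reachableSetoid.finsetClasses, (C.card : ℝ)) ^ 2 =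
      Real.exp n * n ! * PowerSeries.coeff n (PowerSeries.mk selfMapSeq ^ k) := by
  rw [← sum_surjective_prod_card, Finset.mul_sum]
  have h1 : ∀ F ∈ forestsWith (Fin n) k,
      (k ! : ℝ) * (∏ C ∈ F.reachableSetoid.finsetClasses, (C.card : ℝ)) ^ 2 =
      ∑ q ∈ Finset.univ.filter (fun q : Fin n → Fin k => Function.Surjective q),
        if Setoid.ker q = F.reachableSetoid then
          (∏ C ∈ F.reachableSetoid.finsetClasses, (C.card : ℝ)) ^ 2 else 0 := by
    intro F hF
    have hc := card_surjective_ker_eq _ (mem_forestsWith.1 hF).2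
    rw [← Finset.sum_filter, Finset.filter_filter, Finset.sum_const, nsmul_eq_mul, ← hc]
    congr!
  rw [Finset.sum_congr rfl h1, Finset.sum_comm]
  refine Finset.sum_congr rfl fun q hq => ?_
  have hq : Function.Surjective q := (Finset.mem_filter.1 hq).2
  have h2 := card_forestsAbove_bot (Setoid.ker q)
  have h3 (v : Fin n) : (Setoid.ker q).finsetClass v = Finset.univ.filter fun w => q w = q v := by
    ext w
    simp [Setoid.ker_def, eq_comm]
  have h4 : (Setoid.ker q).finsetClasses.card = k := by
    rw [Setoid.card_finsetClasses_eq,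
      Nat.card_congr (Setoid.quotientKerEquivOfSurjective (f := q) hq), Nat.card_fin]
  simp only [h3] at h2
  rw [← h2, ← Finset.sum_filter]
  have h5 : (forestsWith (Fin n) k).filter (fun F => Setoid.ker q = F.reachableSetoid) =
      (⊥ : SimpleGraph (Fin n)).forestsAbove (Setoid.ker q) := by
    ext F
    rw [mem_forestsAbove, Finset.mem_filter, mem_forestsWith]
    constructor
    · rintro ⟨⟨h, -⟩, h'⟩
      exact ⟨bot_le, h, h'.symm⟩
    · rintro ⟨-, h, h'⟩
      exact ⟨⟨h, by rw [h', h4]⟩, h'.symm⟩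
  have h6 : ∀ F ∈ (⊥ : SimpleGraph (Fin n)).forestsAbove (Setoid.ker q),
      (∏ C ∈ F.reachableSetoid.finsetClasses, (C.card : ℝ)) ^ 2 =
        ∏ B ∈ (Setoid.ker q).finsetClasses, (B.card : ℝ) ^ 2 := by
    intro F hF
    rw [(mem_forestsAbove.1 hF).2.2, Finset.prod_pow]
  rw [h5, Finset.sum_congr rfl h6, Finset.sum_const, nsmul_eq_mul]

/-- The sum, over the forests with `k` components, of the squared number of trees above them. -/
theorem sum_sq_card_trees_above {n : ℕ} (hn : 0 < n) (k : ℕ) :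
    k ! * (∑ F ∈ forestsWith (Fin n) k, ((F.forestsAbove ⊤).card : ℝ) ^ 2) * (n : ℝ) ^ 4 =
      (n : ℝ) ^ (2 * k) *
        (Real.exp n * n ! * PowerSeries.coeff n (PowerSeries.mk selfMapSeq ^ k)) := by
  have : Nonempty (Fin n) := ⟨⟨0, hn⟩⟩
  rw [← sum_forestsWith, mul_assoc, Finset.sum_mul, mul_left_comm, Finset.mul_sum _ _ ((n : ℝ) ^ _)]
  congr 1
  refine Finset.sum_congr rfl fun F hF => ?_
  obtain ⟨hF, hk⟩ := mem_forestsWith.1 hF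
  have h := card_trees_above hF
  rw [Fintype.card_fin, hk] at h
  calc _ = (((F.forestsAbove ⊤).card : ℝ) * (n : ℝ) ^ 2) ^ 2 := by ring
    _ = _ := by rw [h]; ring

end SimpleGraph

/-! ### Pairs of trees and their common subforests -/

namespace SimpleGraph

open scoped Nat

section

variable {V : Type*}

lemma isTree_iff_reachableSetoid_eq_top [Nonempty V] {G : SimpleGraph V} :
    G.IsTree ↔ G.IsAcyclic ∧ G.reachableSetoid = ⊤ := by
  constructor
  · intro h
    refine ⟨h.isAcyclic, top_le_iff.1 fun u v _ => ?_⟩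
    exact h.connected.preconnected u v
  · rintro ⟨h, h'⟩
    refine ⟨⟨fun u v => ?_⟩, h⟩
    rw [← reachableSetoid_apply, h']
    trivial

variable [Fintype V]

open scoped Classical in
-- A common subforest is a set of common edges, any such set is acyclic, and having `k` components
-- means having `|V| - k` edges.
lemma card_forestsWith_le {T₁ T₂ : SimpleGraph V} (h₁ : T₁.IsAcyclic) {k : ℕ}
    (hk : k ≤ Fintype.card V) :
    ((forestsWith V k).filter fun F => F ≤ T₁ ∧ F ≤ T₂).card =
      (T₁.edgeSet ∩ T₂.edgeSet).ncard.choose (Fintype.card V - k) := by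
  rw [Set.ncard_eq_toFinset_card', ← Finset.card_powersetCard]
  refine Finset.card_bij' (fun F _ => F.edgeFinset)
    (fun E _ => fromEdgeSet (E : Set (Sym2 V))) ?_ ?_ ?_ ?_
  · intro F hF
    obtain ⟨hF, hle₁, hle₂⟩ := Finset.mem_filter.1 hF
    obtain ⟨hF, hc⟩ := mem_forestsWith.1 hF
    have := hF.ncard_edgeSet_add
    rw [Set.ncard_eq_toFinset_card', ← edgeFinset] at this
    rw [Finset.mem_powersetCard]
    refine ⟨fun e he => ?_, by omega⟩
    rw [mem_edgeFinset] at he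
    simpa using ⟨edgeSet_mono hle₁ he, edgeSet_mono hle₂ he⟩
  · intro E hE
    obtain ⟨hE, hc⟩ := Finset.mem_powersetCard.1 hE
    have hE₁ : (E : Set (Sym2 V)) ⊆ T₁.edgeSet := fun e he => by
      have := hE (Finset.mem_coe.1 he)
      rw [Set.mem_toFinset] at this
      exact this.1
    have hE₂ : (E : Set (Sym2 V)) ⊆ T₂.edgeSet := fun e he => by
      have := hE (Finset.mem_coe.1 he)
      rw [Set.mem_toFinset] at this
      exact this.2
    have hle₁ : fromEdgeSet (E : Set (Sym2 V)) ≤ T₁ := by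
      rw [← fromEdgeSet_edgeSet T₁]
      exact fromEdgeSet_mono hE₁
    have hle₂ : fromEdgeSet (E : Set (Sym2 V)) ≤ T₂ := by
      rw [← fromEdgeSet_edgeSet T₂]
      exact fromEdgeSet_mono hE₂
    have hac := h₁.anti hle₁
    have hset : (fromEdgeSet (E : Set (Sym2 V))).edgeSet = E := by
      rw [edgeSet_fromEdgeSet, sdiff_eq_left, Set.disjoint_left]
      exact fun e he hd => T₁.not_isDiag_of_mem_edgeSet (hE₁ he) hd
    have := hac.ncard_edgeSet_add
    rw [hset, Set.ncard_coe_finset] at this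
    rw [Finset.mem_filter, mem_forestsWith]
    exact ⟨⟨hac, by omega⟩, hle₁, hle₂⟩
  · intro F _
    rw [coe_edgeFinset, fromEdgeSet_edgeSet]
  · intro E hE
    obtain ⟨hE, hc⟩ := Finset.mem_powersetCard.1 hE
    ext e
    refine (@Set.mem_toFinset _ _ (_) e).trans ?_
    rw [edgeSet_fromEdgeSet]
    constructor
    · exact fun h => h.1
    · intro he
      have := hE he
      rw [Set.mem_toFinset] at this
      exact ⟨he, fun hd => T₁.not_isDiag_of_mem_edgeSet this.1 hd⟩

end

open scoped Classical in
lemma card_forestsAbove_top {n : ℕ} (hn : 0 < n) (F : SimpleGraph (Fin n)) :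
    (F.forestsAbove ⊤).card = ∑ T : LabeledTree n, if F ≤ T.val then 1 else 0 := by
  have : Nonempty (Fin n) := ⟨⟨0, hn⟩⟩
  rw [← Finset.card_filter]
  refine (Finset.card_bij (fun T _ => T.val) ?_ ?_ ?_).symm
  · intro T hT
    rw [mem_forestsAbove]
    exact ⟨(Finset.mem_filter.1 hT).2, isTree_iff_reachableSetoid_eq_top.1 T.2⟩
  · exact fun T _ T' _ h => Subtype.ext h
  · intro T hT
    rw [mem_forestsAbove] at hT
    exact ⟨⟨T, isTree_iff_reachableSetoid_eq_top.2 hT.2⟩, by simpa using hT.1, rfl⟩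

/-- Counting triples of a forest with `k` components and two trees above it. -/
lemma sum_sq_card_forestsAbove {n k : ℕ} (hn : 0 < n) (hk : k ≤ n) :
    ∑ F ∈ forestsWith (Fin n) k, (F.forestsAbove ⊤).card ^ 2 =
      ∑ T : LabeledTree n, ∑ T' : LabeledTree n,
        (T'.val.edgeSet ∩ T.val.edgeSet).ncard.choose (n - k) := by
  classical
  have h (T T' : LabeledTree n) : (T'.val.edgeSet ∩ T.val.edgeSet).ncard.choose (n - k) =
      ∑ F ∈ forestsWith (Fin n) k, if F ≤ T'.val ∧ F ≤ T.val then 1 else 0 := by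
    have := card_forestsWith_le (T₂ := T.val) T'.2.isAcyclic (k := k) (by simpa using hk)
    rw [Fintype.card_fin] at this
    rw [← this, Finset.card_filter]
  simp_rw [h]
  rw [Finset.sum_congr rfl fun T _ => Finset.sum_comm, Finset.sum_comm]
  refine Finset.sum_congr rfl fun F _ => ?_
  rw [card_forestsAbove_top hn, sq, Finset.sum_mul_sum]
  refine Finset.sum_congr rfl fun T _ => Finset.sum_congr rfl fun T' _ => ?_
  by_cases h1 : F ≤ T.val <;> by_cases h2 : F ≤ T'.val <;> simp [h1, h2]

end SimpleGraph

/-! ### Sandwiching the ball size between forest sums -/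

open scoped Classical in
lemma treeBallSize_eq_sum {n t : ℕ} (ht : t + 1 ≤ n) (T : LabeledTree n) :
    treeBallSize T t = ∑ T' : LabeledTree n,
      if n - (t + 1) ≤ (T'.val.edgeSet ∩ T.val.edgeSet).ncard then 1 else 0 := by
  rw [← Finset.card_filter, treeBallSize, ← Set.ncard_coe_finset]
  congr 1
  ext T'
  simp only [treeBall, treeDist, Set.mem_ofPred_eq, Finset.coe_filter, Finset.mem_univ, true_and]
  omega

/-- For `j > m` the indicator is not needed: `(m + 1) * j.choose (m + 1) = (j - m) * j.choose m ≥
j.choose m`. -/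
lemma Nat.choose_le_ite_add_mul_choose_succ {j m n : ℕ} (h : m + 1 ≤ n) :
    j.choose m ≤ (if m ≤ j then 1 else 0) + n * j.choose (m + 1) := by
  rcases lt_trichotomy j m with hj | rfl | hj
  · simp [Nat.choose_eq_zero_of_lt hj]
  · simp
  · have h1 := Nat.choose_succ_right_eq j m
    have h2 : j.choose m * 1 ≤ j.choose m * (j - m) := Nat.mul_le_mul_left _ (by omega)
    have h3 : (m + 1) * j.choose (m + 1) ≤ n * j.choose (m + 1) := Nat.mul_le_mul_right _ h
    rw [← h1] at h2
    rw [mul_comm] at h3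
    omega

open SimpleGraph in
lemma sum_treeBallSize_le {n t : ℕ} (ht : t + 1 ≤ n) :
    ∑ T : LabeledTree n, treeBallSize T t ≤
      ∑ F ∈ forestsWith (Fin n) (t + 1), (F.forestsAbove ⊤).card ^ 2 := by
  rw [sum_sq_card_forestsAbove (by omega) ht]
  refine Finset.sum_le_sum fun T _ => ?_
  rw [treeBallSize_eq_sum ht]
  refine Finset.sum_le_sum fun T' _ => ?_
  split_ifs with h
  · exact Nat.choose_pos h
  · exact Nat.zero_le _

open SimpleGraph in
lemma le_sum_treeBallSize_add {n t : ℕ} (ht : t + 1 ≤ n) :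
    ∑ F ∈ forestsWith (Fin n) (t + 1), (F.forestsAbove ⊤).card ^ 2 ≤
      ∑ T : LabeledTree n, treeBallSize T t +
        n * ∑ F ∈ forestsWith (Fin n) t, (F.forestsAbove ⊤).card ^ 2 := by
  rw [sum_sq_card_forestsAbove (by omega) ht, sum_sq_card_forestsAbove (by omega) (by omega),
    Finset.mul_sum, ← Finset.sum_add_distrib]
  refine Finset.sum_le_sum fun T _ => ?_
  rw [treeBallSize_eq_sum ht, Finset.mul_sum, ← Finset.sum_add_distrib]
  refine Finset.sum_le_sum fun T' _ => ?_
  rw [show n - t = n - (t + 1) + 1 by omega]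
  exact Nat.choose_le_ite_add_mul_choose_succ (by omega)

open scoped Nat

/-- The normalized sum, over forests with `k` components, of the squared number of trees above. -/
noncomputable def forestSquareSum (n k : ℕ) : ℝ :=
  (n : ℝ) ^ (2 * k) / n ^ 2 / k ! *
    (PowerSeries.coeff n (PowerSeries.mk selfMapSeq ^ k) * (Real.exp n * n ! / (n : ℝ) ^ n))

open SimpleGraph in
lemma forestSquareSum_eq {n : ℕ} (hn : 0 < n) (k : ℕ) :
    forestSquareSum n k = (∑ F ∈ forestsWith (Fin n) k, ((F.forestsAbove ⊤).card : ℝ) ^ 2) /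
      (n : ℝ) ^ ((n : ℤ) - 2) := by
  have h := sum_sq_card_trees_above hn k
  have hn' : (n : ℝ) ≠ 0 := by positivity
  have hz : (n : ℝ) ^ ((n : ℤ) - 2) = (n : ℝ) ^ n / (n : ℝ) ^ 2 := by
    rw [zpow_sub₀ hn', zpow_natCast]
    norm_cast
  have hk : (k ! : ℝ) ≠ 0 := by positivity
  rw [hz, forestSquareSum]
  field_simp
  linear_combination -h

lemma averageBallSize_le {n t : ℕ} (ht : t + 1 ≤ n) :
    averageBallSize n t ≤ forestSquareSum n (t + 1) := by
  rw [forestSquareSum_eq (by omega), averageBallSize]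
  gcongr
  exact_mod_cast sum_treeBallSize_le ht

lemma sub_le_averageBallSize {n t : ℕ} (ht : t + 1 ≤ n) :
    forestSquareSum n (t + 1) - n * forestSquareSum n t ≤ averageBallSize n t := by
  rw [forestSquareSum_eq (by omega), forestSquareSum_eq (by omega), averageBallSize, mul_div_assoc',
    ← sub_div]
  gcongr
  rw [sub_le_iff_le_add]
  exact_mod_cast le_sum_treeBallSize_add ht

open scoped Nat

/-! ### Coefficientwise comparison of power series -/

section PowerSeriesOrder

open PowerSeries

lemma PowerSeries.coeff_mul_le_coeff_mul {f f' g g' : PowerSeries ℝ} (hf : ∀ n, 0 ≤ coeff n f)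
    (hg' : ∀ n, 0 ≤ coeff n g') (hff' : ∀ n, coeff n f ≤ coeff n f')
    (hgg' : ∀ n, coeff n g ≤ coeff n g') (n : ℕ) : coeff n (f * g) ≤ coeff n (f' * g') := by
  rw [coeff_mul, coeff_mul]
  exact Finset.sum_le_sum fun x _ =>
    (mul_le_mul_of_nonneg_left (hgg' _) (hf _)).trans (mul_le_mul_of_nonneg_right (hff' _) (hg' _))

lemma PowerSeries.coeff_pow_nonneg {f : PowerSeries ℝ} (hf : ∀ n, 0 ≤ coeff n f) (k n : ℕ) :
    0 ≤ coeff n (f ^ k) := by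
  induction k generalizing n with
  | zero => rw [pow_zero, coeff_one]; positivity
  | succ k ih =>
    rw [pow_succ, coeff_mul]
    exact Finset.sum_nonneg fun x _ => mul_nonneg (ih _) (hf _)

lemma PowerSeries.coeff_pow_le_coeff_pow {f g : PowerSeries ℝ} (hf : ∀ n, 0 ≤ coeff n f)
    (hfg : ∀ n, coeff n f ≤ coeff n g) (k n : ℕ) : coeff n (f ^ k) ≤ coeff n (g ^ k) := by
  induction k generalizing n with
  | zero => simp
  | succ k ih =>
    rw [pow_succ, pow_succ]
    exact coeff_mul_le_coeff_mul (coeff_pow_nonneg hf k) (fun n => (hf n).trans (hfg n)) ih hfg n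

end PowerSeriesOrder

/-! ### Powers of the comparison series -/

/-- The coefficients of `(1 - x) ^ (-1 / 2)`. -/
noncomputable def invSqrtSeq (n : ℕ) : ℝ := (n.centralBinom : ℝ) / 4 ^ n

lemma invSqrtSeq_pos (n : ℕ) : 0 < invSqrtSeq n :=
  div_pos (by exact_mod_cast n.centralBinom_pos) (by positivity)

lemma invSqrtSeq_succ (n : ℕ) :
    invSqrtSeq (n + 1) * (n + 1) = invSqrtSeq n * (n + 1 / 2) := by
  have h : ((n : ℝ) + 1) * (n + 1).centralBinom = 2 * (2 * n + 1) * n.centralBinom := by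
    exact_mod_cast Nat.succ_mul_centralBinom_succ n
  unfold invSqrtSeq
  rw [pow_succ]
  field_simp
  linear_combination 2 * h

lemma invSqrtSeq_le_two_mul_succ (n : ℕ) : invSqrtSeq n ≤ 2 * invSqrtSeq (n + 1) := by
  have h := invSqrtSeq_succ n
  have h' := invSqrtSeq_pos n
  have : 0 < (n : ℝ) + 1 := by positivity
  rw [← mul_le_mul_iff_left₀ this]
  nlinarith [mul_nonneg h'.le (Nat.cast_nonneg (α := ℝ) n)]

/-- The series satisfies `P' (1 - X) = P / 2`, so `(P ^ k)' (1 - X) = (k / 2) P ^ k`; coefficients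
are then compared. -/
lemma coeff_invSqrtSeq_pow_succ (k n : ℕ) :
    PowerSeries.coeff (n + 1) (PowerSeries.mk invSqrtSeq ^ k) * (n + 1) =
      PowerSeries.coeff n (PowerSeries.mk invSqrtSeq ^ k) * (k / 2 + n) := by
  set P := PowerSeries.mk invSqrtSeq with hP
  have h1 : PowerSeries.derivative ℝ P * (1 - PowerSeries.X) = PowerSeries.C (1 / 2 : ℝ) * P := by
    ext m
    rw [mul_sub, mul_one, map_sub, PowerSeries.coeff_C_mul, PowerSeries.coeff_derivative]
    cases m with
    | zero =>
      have := invSqrtSeq_succ 0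
      simp [hP] at this ⊢
      linarith
    | succ m =>
      rw [PowerSeries.coeff_succ_mul_X, PowerSeries.coeff_derivative]
      simp only [hP, PowerSeries.coeff_mk]
      have := invSqrtSeq_succ (m + 1)
      push_cast at this ⊢
      linarith
  have h2 : PowerSeries.derivative ℝ (P ^ k) * (1 - PowerSeries.X) =
      PowerSeries.C (k / 2 : ℝ) * P ^ k := by
    cases k with
    | zero => simp
    | succ k =>
      rw [Derivation.leibniz_pow, add_tsub_cancel_right, smul_eq_mul, nsmul_eq_mul, mul_assoc,
        mul_assoc, h1]
      have : (PowerSeries.C (((k + 1 : ℕ) : ℝ) / 2)) =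
          ((k + 1 : ℕ) : PowerSeries ℝ) * PowerSeries.C (1 / 2 : ℝ) := by
        rw [← map_natCast (PowerSeries.C (R := ℝ)), ← map_mul]
        congr 1
        ring
      rw [this]
      ring
  have h3 := congrArg (PowerSeries.coeff n) h2
  rw [mul_sub, mul_one, map_sub, PowerSeries.coeff_C_mul, PowerSeries.coeff_derivative] at h3
  cases n with
  | zero =>
    simp at h3 ⊢
    linarith
  | succ m =>
    rw [PowerSeries.coeff_succ_mul_X, PowerSeries.coeff_derivative] at h3
    push_cast at h3 ⊢
    linarith

lemma coeff_invSqrtSeq_pow_mul_factorial (k n : ℕ) :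
    PowerSeries.coeff n (PowerSeries.mk invSqrtSeq ^ k) * n ! =
      ∏ j ∈ Finset.range n, ((k : ℝ) / 2 + j) := by
  induction n with
  | zero => simp [invSqrtSeq]
  | succ n ih =>
    rw [Finset.prod_range_succ, ← ih, Nat.factorial_succ]
    push_cast
    linear_combination (n ! : ℝ) * coeff_invSqrtSeq_pow_succ k n

lemma coeff_invSqrtSeq_sq (n : ℕ) :
    PowerSeries.coeff n (PowerSeries.mk invSqrtSeq ^ 2) = 1 := by
  have h := coeff_invSqrtSeq_pow_mul_factorial 2 n
  have h' : ∏ j ∈ Finset.range n, (((2 : ℕ) : ℝ) / 2 + j) = n ! := by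
    rw [← Finset.prod_range_add_one_eq_factorial]
    push_cast
    exact Finset.prod_congr rfl fun j _ => by ring
  rw [h'] at h
  exact (mul_eq_right₀ (by positivity)).1 h

lemma tendsto_coeff_invSqrtSeq_pow {k : ℕ} (hk : 0 < k) :
    Tendsto (fun n : ℕ => PowerSeries.coeff n (PowerSeries.mk invSqrtSeq ^ k) /
      (n : ℝ) ^ ((k : ℝ) / 2 - 1)) atTop (𝓝 (1 / Real.Gamma (k / 2))) := by
  have hs : (0 : ℝ) < (k : ℝ) / 2 := by positivity
  -- Euler's product for `Γ(k/2)` has the extra factor `k/2 + n`, which this quotient removes.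
  have h1 : Tendsto (fun n : ℕ => (n : ℝ) / (n + (k : ℝ) / 2)) atTop (𝓝 1) :=
    tendsto_natCast_div_add_atTop _
  have h2 := h1.div (Real.GammaSeq_tendsto_Gamma ((k : ℝ) / 2)) (Real.Gamma_pos_of_pos hs).ne'
  refine h2.congr' ?_
  filter_upwards [eventually_gt_atTop 0] with n hn
  have hn' : (0 : ℝ) < n := by exact_mod_cast hn
  have h := coeff_invSqrtSeq_pow_mul_factorial k n
  have hp : (0 : ℝ) < ∏ j ∈ Finset.range n, ((k : ℝ) / 2 + j) :=
    Finset.prod_pos fun j _ => by positivity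
  simp only [Pi.div_apply]
  rw [Real.GammaSeq, Finset.prod_range_succ, ← h, Real.rpow_sub_one hn'.ne']
  have : (0 : ℝ) < (n : ℝ) ^ ((k : ℝ) / 2) := by positivity
  have hf : (0 : ℝ) < n ! := by positivity
  rw [← h] at hp
  have hc := (pos_iff_pos_of_mul_pos hp).2 hf
  field_simp
  ring

lemma coeff_invSqrtSeq_pow_isTheta {k : ℕ} (hk : 0 < k) :
    (fun n : ℕ => PowerSeries.coeff n (PowerSeries.mk invSqrtSeq ^ k)) =Θ[atTop]
      fun n : ℕ => (n : ℝ) ^ ((k : ℝ) / 2 - 1) := by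
  refine (isTheta_of_div_tendsto_nhds_ne_zero (tendsto_coeff_invSqrtSeq_pow hk) ?_).symm
  have hs : (0 : ℝ) < (k : ℝ) / 2 := by positivity
  have := Real.Gamma_pos_of_pos hs
  positivity

lemma tendsto_invSqrtSeq_mul_sqrt :
    Tendsto (fun n : ℕ => invSqrtSeq n * √n) atTop (𝓝 (1 / √Real.pi)) := by
  have h := tendsto_coeff_invSqrtSeq_pow one_pos
  rw [Nat.cast_one, Real.Gamma_one_half_eq] at h
  refine h.congr fun n => ?_
  rw [pow_one, PowerSeries.coeff_mk, show (1 / 2 - 1 : ℝ) = -(1 / 2) by norm_num,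
    Real.rpow_neg (Nat.cast_nonneg n), div_inv_eq_mul, Real.sqrt_eq_rpow]

lemma tendsto_invSqrtSeq : Tendsto invSqrtSeq atTop (𝓝 0) := by
  have h : Tendsto (fun n : ℕ => √(n : ℝ)) atTop atTop :=
    Real.tendsto_sqrt_atTop.comp tendsto_natCast_atTop_atTop
  refine (tendsto_invSqrtSeq_mul_sqrt.div_atTop h).congr' ?_
  filter_upwards [eventually_gt_atTop 0] with n hn
  have : √(n : ℝ) ≠ 0 := by positivity
  field_simp

/-! ### Stirling's formula and transfer to the self-map series -/

lemma exp_mul_factorial_div_pow {n : ℕ} (hn : 0 < n) :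
    Real.exp n * n ! / (n : ℝ) ^ n = Stirling.stirlingSeq n * √(2 * n) := by
  have : √(2 * (n : ℝ)) ≠ 0 := by positivity
  rw [Stirling.stirlingSeq, div_pow, ← Real.exp_nat_mul, mul_one]
  field_simp

lemma tendsto_exp_mul_factorial_div_pow :
    Tendsto (fun n : ℕ => Real.exp n * n ! / (n : ℝ) ^ n / √n) atTop (𝓝 √(2 * Real.pi)) := by
  have h := Stirling.tendsto_stirlingSeq_sqrt_pi.mul_const √2
  rw [← Real.sqrt_mul Real.pi_pos.le, mul_comm Real.pi] at h
  refine h.congr' ?_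
  filter_upwards [eventually_gt_atTop 0] with n hn
  have : √(n : ℝ) ≠ 0 := by positivity
  rw [exp_mul_factorial_div_pow hn, Real.sqrt_mul (by norm_num)]
  field_simp

lemma selfMapSeq_nonneg (n : ℕ) : 0 ≤ selfMapSeq n := by
  unfold selfMapSeq
  split_ifs <;> positivity

lemma selfMapSeq_eq_inv {n : ℕ} (hn : 0 < n) :
    selfMapSeq n = (Real.exp n * n ! / (n : ℝ) ^ n)⁻¹ := by
  rw [selfMapSeq, if_neg hn.ne', Real.exp_neg, inv_div]
  field_simp

lemma selfMapSeq_pos {n : ℕ} (hn : 0 < n) : 0 < selfMapSeq n := by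
  rw [selfMapSeq_eq_inv hn]
  positivity

lemma tendsto_selfMapSeq_div_invSqrtSeq :
    Tendsto (fun n => selfMapSeq n / invSqrtSeq n) atTop (𝓝 (1 / √2)) := by
  have h := (tendsto_exp_mul_factorial_div_pow.mul tendsto_invSqrtSeq_mul_sqrt).inv₀ (by positivity)
  have he : (√(2 * Real.pi) * (1 / √Real.pi))⁻¹ = 1 / √2 := by
    rw [Real.sqrt_mul (by norm_num)]
    have : √Real.pi ≠ 0 := by positivity
    field_simp
  rw [he] at h
  refine h.congr' ?_
  filter_upwards [eventually_gt_atTop 0] with n hn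
  have h1 : √(n : ℝ) ≠ 0 := by positivity
  have h2 := (invSqrtSeq_pos n).ne'
  rw [selfMapSeq_eq_inv hn]
  field_simp

/-- Convolving `d = o(p)` with `e = O(p)`, where `p` is bounded under self-convolution. -/
lemma tendsto_coeff_mul_zero {p d e : ℕ → ℝ} (hp : ∀ n, 0 ≤ p n) (hp0 : Tendsto p atTop (𝓝 0))
    (hpp : ∀ n, PowerSeries.coeff n (PowerSeries.mk p ^ 2) ≤ 1) (hd : d =o[atTop] p) {c : ℝ}
    (he : ∀ n, |e n| ≤ c * p n) :
    Tendsto (fun n => PowerSeries.coeff n (PowerSeries.mk d * PowerSeries.mk e)) atTop (𝓝 0) := by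
  have hc : 0 ≤ |c| := abs_nonneg c
  have he' (n : ℕ) : |e n| ≤ |c| * p n :=
    (he n).trans (mul_le_mul_of_nonneg_right (le_abs_self c) (hp n))
  rw [Metric.tendsto_atTop]
  intro ε hε
  set η := ε / 2 / (|c| + 1) with hη
  have hη0 : 0 < η := by positivity
  -- Beyond `M` the terms are at most `η * |c|` times those of the self-convolution of `p`. The
  -- first `M` terms are finitely many and each tends to 0.
  obtain ⟨M, hM⟩ := eventually_atTop.1 (hd.bound hη0)
  have hfin : Tendsto (fun n => ∑ a ∈ Finset.range M, |d a| * (|c| * p (n - a))) atTop (𝓝 0) := by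
    have : Tendsto (fun n => ∑ a ∈ Finset.range M, |d a| * (|c| * p (n - a))) atTop
        (𝓝 (∑ a ∈ Finset.range M, |d a| * (|c| * 0))) := by
      refine tendsto_finsetSum _ fun a _ => ?_
      exact ((hp0.comp (tendsto_sub_atTop_nat a)).const_mul _).const_mul _
    simpa using this
  obtain ⟨N, hN⟩ := Metric.tendsto_atTop.1 hfin (ε / 2) (by positivity)
  refine ⟨max N M, fun n hn => ?_⟩
  have hN' := hN n ((le_max_left _ _).trans hn)
  have hMn : M ≤ n := (le_max_right _ _).trans hn
  rw [Real.dist_eq, sub_zero] at hN' ⊢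
  have h1 := hpp n
  rw [sq, PowerSeries.coeff_mul, Finset.Nat.sum_antidiagonal_eq_sum_range_succ_mk] at h1
  simp only [PowerSeries.coeff_mk] at h1
  rw [PowerSeries.coeff_mul, Finset.Nat.sum_antidiagonal_eq_sum_range_succ_mk]
  simp only [PowerSeries.coeff_mk]
  calc |∑ a ∈ Finset.range n.succ, d a * e (n - a)|
      ≤ ∑ a ∈ Finset.range n.succ, |d a * e (n - a)| := Finset.abs_sum_le_sum_abs _ _
    _ ≤ ∑ a ∈ Finset.range n.succ, ((if a < M then |d a| * (|c| * p (n - a)) else 0) +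
          η * |c| * (p a * p (n - a))) := by
        refine Finset.sum_le_sum fun a _ => ?_
        rw [abs_mul]
        have h2 := he' (n - a)
        have h3 := hp (n - a)
        have h4 := hp a
        split_ifs with ha
        · have : 0 ≤ η * |c| * (p a * p (n - a)) := by positivity
          have := mul_le_mul_of_nonneg_left h2 (abs_nonneg (d a))
          linarith
        · have h5 := hM a (not_lt.1 ha)
          rw [Real.norm_eq_abs, Real.norm_eq_abs, abs_of_nonneg h4] at h5
          have := mul_le_mul h5 h2 (abs_nonneg _) (by positivity)
          linarith
    _ = (∑ a ∈ Finset.range M, |d a| * (|c| * p (n - a))) +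
          η * |c| * ∑ a ∈ Finset.range n.succ, p a * p (n - a) := by
        rw [Finset.sum_add_distrib, ← Finset.mul_sum, ← Finset.sum_filter]
        congr 2
        ext a
        simp only [Finset.mem_filter, Finset.mem_range]
        omega
    _ < ε / 2 + ε / 2 := by
        refine add_lt_add_of_lt_of_le ((le_abs_self _).trans_lt hN') ?_
        calc _ ≤ η * |c| * 1 := by gcongr
          _ ≤ η * (|c| + 1) := by nlinarith
          _ = ε / 2 := by rw [hη]; field_simp
    _ = ε := by ring

lemma exists_selfMapSeq_le : ∃ C, 0 < C ∧ ∀ n, selfMapSeq n ≤ C * invSqrtSeq n := by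
  obtain ⟨C, hC⟩ := tendsto_selfMapSeq_div_invSqrtSeq.bddAbove_range
  refine ⟨max C 1, by positivity, fun n => ?_⟩
  have h := hC ⟨n, rfl⟩
  rw [div_le_iff₀ (invSqrtSeq_pos n)] at h
  exact h.trans (mul_le_mul_of_nonneg_right (le_max_left _ _) (invSqrtSeq_pos n).le)

/-- The index shift is forced by `selfMapSeq 0 = 0`, and costs the factor 2 in the constant. -/
lemma exists_le_selfMapSeq : ∃ c, 0 < c ∧ ∀ n, c * invSqrtSeq n ≤ selfMapSeq (n + 1) := by
  obtain ⟨C, hC⟩ := (tendsto_selfMapSeq_div_invSqrtSeq.inv₀ (by positivity)).bddAbove_range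
  refine ⟨(2 * max C 1)⁻¹, by positivity, fun n => ?_⟩
  have h := hC ⟨n + 1, rfl⟩
  have hpos := selfMapSeq_pos n.succ_pos
  simp only [inv_div] at h
  rw [div_le_iff₀ hpos] at h
  rw [inv_mul_le_iff₀ (by positivity)]
  have h1 := invSqrtSeq_le_two_mul_succ n
  have h2 := mul_le_mul_of_nonneg_right (le_max_left C 1) hpos.le
  linarith

/-- With `U` the self-map series and `P` the comparison series, `U² - P²/2 = (U - P/√2) (U + P/√2)`.
The first factor has coefficients `o(p)` and the second `O(p)`, where `p` are those of `P`, while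
`P²` has all coefficients 1. -/
lemma tendsto_coeff_selfMapSeq_sq :
    Tendsto (fun n => PowerSeries.coeff n (PowerSeries.mk selfMapSeq ^ 2)) atTop (𝓝 (1 / 2)) := by
  obtain ⟨C, hC0, hC⟩ := exists_selfMapSeq_le
  have h := tendsto_coeff_mul_zero (d := fun n => selfMapSeq n - 1 / √2 * invSqrtSeq n)
    (e := fun n => selfMapSeq n + 1 / √2 * invSqrtSeq n) (c := C + 1 / √2)
    (fun n => (invSqrtSeq_pos n).le) tendsto_invSqrtSeq (fun n => (coeff_invSqrtSeq_sq n).le) ?_ ?_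
  · have h' := h.add_const (1 / 2)
    rw [zero_add] at h'
    refine h'.congr fun n => ?_
    have hd : PowerSeries.mk (fun n => selfMapSeq n - 1 / √2 * invSqrtSeq n) =
        PowerSeries.mk selfMapSeq - PowerSeries.C (1 / √2) * PowerSeries.mk invSqrtSeq := by
      ext; simp
    have he : PowerSeries.mk (fun n => selfMapSeq n + 1 / √2 * invSqrtSeq n) =
        PowerSeries.mk selfMapSeq + PowerSeries.C (1 / √2) * PowerSeries.mk invSqrtSeq := by
      ext; simp
    have hm : (PowerSeries.mk selfMapSeq - PowerSeries.C (1 / √2) * PowerSeries.mk invSqrtSeq) *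
        (PowerSeries.mk selfMapSeq + PowerSeries.C (1 / √2) * PowerSeries.mk invSqrtSeq) =
        PowerSeries.mk selfMapSeq ^ 2 -
          PowerSeries.C ((1 / √2) ^ 2) * PowerSeries.mk invSqrtSeq ^ 2 := by
      rw [map_pow]
      ring
    rw [hd, he, hm, map_sub, PowerSeries.coeff_C_mul, coeff_invSqrtSeq_sq, div_pow,
      Real.sq_sqrt (by norm_num)]
    ring
  · rw [isLittleO_iff_tendsto fun n hn => absurd hn (invSqrtSeq_pos n).ne']
    have h' := tendsto_selfMapSeq_div_invSqrtSeq.sub_const (1 / √2)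
    rw [sub_self] at h'
    refine h'.congr fun n => ?_
    have := (invSqrtSeq_pos n).ne'
    field_simp
  · intro n
    have := invSqrtSeq_pos n
    rw [abs_of_nonneg (add_nonneg (selfMapSeq_nonneg n) (by positivity)), add_mul]
    linarith [hC n]

/-- Consecutive coefficients have ratio `(k/2 + n) / (n + 1) ≤ k`. This absorbs the shift by `X ^ k`
in the lower bound below. -/
lemma coeff_invSqrtSeq_pow_le {k : ℕ} (hk : 0 < k) (m j : ℕ) :
    PowerSeries.coeff (m + j) (PowerSeries.mk invSqrtSeq ^ k) ≤
      k ^ j * PowerSeries.coeff m (PowerSeries.mk invSqrtSeq ^ k) := by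
  induction j with
  | zero => simp
  | succ j ih =>
    have h := coeff_invSqrtSeq_pow_succ k (m + j)
    have h0 := PowerSeries.coeff_pow_nonneg
      (f := PowerSeries.mk invSqrtSeq) (fun n => by simpa using (invSqrtSeq_pos n).le) k (m + j)
    set x := PowerSeries.coeff (m + j) (PowerSeries.mk invSqrtSeq ^ k)
    have hk' : (1 : ℝ) ≤ k := by exact_mod_cast hk
    have hn : (0 : ℝ) ≤ ((m + j : ℕ) : ℝ) := Nat.cast_nonneg _
    have h1 : PowerSeries.coeff (m + j + 1) (PowerSeries.mk invSqrtSeq ^ k) ≤ k * x := by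
      rw [← mul_le_mul_iff_left₀ (by positivity : 0 < ((m + j : ℕ) : ℝ) + 1), h]
      have : (k : ℝ) / 2 + (m + j : ℕ) ≤ k * ((m + j : ℕ) + 1) := by nlinarith
      nlinarith [mul_le_mul_of_nonneg_left this h0]
    calc _ ≤ _ := h1
      _ ≤ k * (k ^ j * PowerSeries.coeff m (PowerSeries.mk invSqrtSeq ^ k)) := by gcongr
      _ = _ := by ring

/-- The bounds `c X P ≤ U ≤ C P` hold coefficientwise and survive taking `k`-th powers. -/
lemma coeff_selfMapSeq_pow_isTheta {k : ℕ} (hk : 0 < k) :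
    (fun n : ℕ => PowerSeries.coeff n (PowerSeries.mk selfMapSeq ^ k)) =Θ[atTop]
      fun n : ℕ => (n : ℝ) ^ ((k : ℝ) / 2 - 1) := by
  refine IsTheta.trans ?_ (coeff_invSqrtSeq_pow_isTheta hk)
  have hu (n : ℕ) : 0 ≤ PowerSeries.coeff n (PowerSeries.mk selfMapSeq) := by
    simpa using selfMapSeq_nonneg n
  have hp (n : ℕ) : 0 ≤ PowerSeries.coeff n (PowerSeries.mk invSqrtSeq) := by
    simpa using (invSqrtSeq_pos n).le
  constructor
  · obtain ⟨C, hC0, hC⟩ := exists_selfMapSeq_le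
    refine IsBigO.of_bound (C ^ k) (Eventually.of_forall fun n => ?_)
    rw [Real.norm_of_nonneg (PowerSeries.coeff_pow_nonneg hu k n),
      Real.norm_of_nonneg (PowerSeries.coeff_pow_nonneg hp k n)]
    have := PowerSeries.coeff_pow_le_coeff_pow (g := PowerSeries.C C * PowerSeries.mk invSqrtSeq)
      hu (fun n => by simpa using hC n) k n
    rwa [mul_pow, ← map_pow, PowerSeries.coeff_C_mul] at this
  · obtain ⟨c, hc0, hc⟩ := exists_le_selfMapSeq
    refine IsBigO.of_bound (k ^ k * (c ^ k)⁻¹) ?_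
    filter_upwards [eventually_ge_atTop k] with n hn
    obtain ⟨m, rfl⟩ := Nat.exists_eq_add_of_le' hn
    rw [Real.norm_of_nonneg (PowerSeries.coeff_pow_nonneg hu k _),
      Real.norm_of_nonneg (PowerSeries.coeff_pow_nonneg hp k _)]
    have h := PowerSeries.coeff_pow_le_coeff_pow
      (f := PowerSeries.C c * (PowerSeries.X * PowerSeries.mk invSqrtSeq))
      (g := PowerSeries.mk selfMapSeq) (fun n => ?_) (fun n => ?_) k (m + k)
    · rw [mul_pow, mul_pow, ← map_pow, PowerSeries.coeff_C_mul, PowerSeries.coeff_X_pow_mul] at h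
      refine (coeff_invSqrtSeq_pow_le hk m k).trans ?_
      rw [mul_assoc]
      gcongr
      rwa [le_inv_mul_iff₀ (by positivity)]
    · cases n with
      | zero => simp
      | succ n =>
        rw [PowerSeries.coeff_C_mul, PowerSeries.coeff_succ_X_mul]
        exact mul_nonneg hc0.le (hp n)
    · cases n with
      | zero => simp [selfMapSeq]
      | succ n =>
        rw [PowerSeries.coeff_C_mul, PowerSeries.coeff_succ_X_mul]
        simpa using hc n

lemma exp_mul_factorial_div_pow_isTheta :
    (fun n : ℕ => Real.exp n * n ! / (n : ℝ) ^ n) =Θ[atTop] fun n : ℕ => (n : ℝ) ^ (1 / 2 : ℝ) := by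
  simp_rw [← Real.sqrt_eq_rpow]
  exact (isTheta_of_div_tendsto_nhds_ne_zero tendsto_exp_mul_factorial_div_pow (by positivity)).symm

/-! ### Order of the forest sums and conclusion -/

lemma forestSquareSum_isTheta {k : ℕ} (hk : 0 < k) :
    (fun n => forestSquareSum n k) =Θ[atTop] fun n : ℕ => (n : ℝ) ^ ((5 / 2 : ℝ) * (k - 1)) := by
  have h1 : (fun n : ℕ => (n : ℝ) ^ (2 * k) / n ^ 2 / (k ! : ℝ)) =Θ[atTop]
      fun n : ℕ => (n : ℝ) ^ (2 * k) / n ^ 2 := by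
    simp_rw [div_eq_mul_inv _ (k ! : ℝ), mul_comm _ (k ! : ℝ)⁻¹]
    exact (isTheta_const_mul_left (by positivity)).2 (isTheta_refl _ _)
  refine (h1.mul ((coeff_selfMapSeq_pow_isTheta hk).mul
    exp_mul_factorial_div_pow_isTheta)).trans_eventuallyEq ?_
  filter_upwards [eventually_gt_atTop 0] with n hn
  have hn' : (0 : ℝ) < n := by exact_mod_cast hn
  rw [← Real.rpow_natCast, ← Real.rpow_natCast, ← Real.rpow_sub hn', ← Real.rpow_add hn',
    ← Real.rpow_add hn']
  congr 1
  push_cast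
  ring

lemma mul_forestSquareSum_isLittleO (t : ℕ) :
    (fun n : ℕ => n * forestSquareSum n t) =o[atTop] fun n => forestSquareSum n (t + 1) := by
  rcases Nat.eq_zero_or_pos t with rfl | ht
  -- There is no forest with zero components on a nonempty vertex set, so the error term vanishes.
  · refine IsLittleO.congr' (isLittleO_zero _ _) ?_ EventuallyEq.rfl
    filter_upwards [eventually_gt_atTop 0] with n hn
    simp [forestSquareSum, PowerSeries.coeff_one, hn.ne']
  · refine IsLittleO.trans_isTheta ?_ (forestSquareSum_isTheta t.succ_pos).symm
    have h : (fun n : ℕ => n * forestSquareSum n t) =Θ[atTop]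
        fun n : ℕ => (n : ℝ) ^ ((5 / 2 : ℝ) * t - 3 / 2) := by
      refine ((isTheta_refl (fun n : ℕ => (n : ℝ)) _).mul
        (forestSquareSum_isTheta ht)).trans_eventuallyEq ?_
      filter_upwards [eventually_gt_atTop 0] with n hn
      have hn' : (0 : ℝ) < n := by exact_mod_cast hn
      rw [← Real.rpow_one_add' hn'.le]
      · congr 1
        ring
      · have : (1 : ℝ) ≤ t := by exact_mod_cast ht
        linarith
    refine h.trans_isLittleO ?_
    have h0 : Tendsto (fun n : ℕ => (n : ℝ) ^ (-(3 / 2) : ℝ)) atTop (𝓝 0) :=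
      (tendsto_rpow_neg_atTop (by norm_num)).comp tendsto_natCast_atTop_atTop
    refine isLittleO_of_tendsto' ?_ (h0.congr' ?_)
    · filter_upwards [eventually_gt_atTop 0] with n hn h'
      exact absurd h' (by positivity)
    · filter_upwards [eventually_gt_atTop 0] with n hn
      have hn' : (0 : ℝ) < n := by exact_mod_cast hn
      rw [← Real.rpow_sub hn']
      congr 1
      push_cast
      ring

lemma averageBallSize_isEquivalent (t : ℕ) :
    (fun n => averageBallSize n t) ~[atTop] fun n => forestSquareSum n (t + 1) := by
  refine IsBigO.trans_isLittleO ?_ (mul_forestSquareSum_isLittleO t)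
  refine IsBigO.of_bound 1 ?_
  filter_upwards [eventually_ge_atTop (t + 1)] with n hn
  have h1 := averageBallSize_le hn
  have h2 := sub_le_averageBallSize hn
  rw [Pi.sub_apply, Real.norm_eq_abs, Real.norm_eq_abs, abs_of_nonpos (by linarith), one_mul]
  exact le_trans (by linarith) (le_abs_self _)

/-- The constant is `1/2!` times the coefficient limit `1/2` times Stirling's `√(2π)`, that is
`(1/2) √(π/2)`. -/
lemma tendsto_forestSquareSum_two :
    Tendsto (fun n : ℕ => forestSquareSum n 2 /
      ((1 / 2 : ℝ) * Real.sqrt (Real.pi / 2) * (n : ℝ) ^ (5 / 2 : ℝ))) atTop (𝓝 1) := by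
  have h := (tendsto_coeff_selfMapSeq_sq.mul tendsto_exp_mul_factorial_div_pow).mul_const
    (1 / √(Real.pi / 2))
  have he : 1 / 2 * √(2 * Real.pi) * (1 / √(Real.pi / 2)) = 1 := by
    rw [show 2 * Real.pi = 2 ^ 2 * (Real.pi / 2) by ring, Real.sqrt_mul (by norm_num),
      Real.sqrt_sq (by norm_num)]
    have : √(Real.pi / 2) ≠ 0 := by positivity
    field_simp
  rw [he] at h
  refine h.congr' ?_
  filter_upwards [eventually_gt_atTop 0] with n hn
  have hn' : (0 : ℝ) < n := by exact_mod_cast hn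
  have h1 : √(n : ℝ) ≠ 0 := by positivity
  have h2 : √(Real.pi / 2) ≠ 0 := by positivity
  have h3 : (n : ℝ) ^ (5 / 2 : ℝ) = n ^ 2 * √n := by
    rw [Real.sqrt_eq_rpow, ← Real.rpow_natCast, ← Real.rpow_add hn']
    norm_num
  rw [forestSquareSum, h3]
  norm_num [Nat.factorial]
  field_simp

theorem mainTheorem2 :
    (∀ t : ℕ,
      (fun n : ℕ => averageBallSize n t) =Θ[atTop]
        (fun n : ℕ => (n : ℝ) ^ ((5 / 2 : ℝ) * (t : ℝ)))) ∧
    Tendsto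
      (fun n : ℕ => averageBallSize n 1 /
        ((1 / 2 : ℝ) * Real.sqrt (Real.pi / 2) * (n : ℝ) ^ (5 / 2 : ℝ)))
      atTop (𝓝 1) := by
  constructor
  · intro t
    have h := (averageBallSize_isEquivalent t).isTheta.trans (forestSquareSum_isTheta t.succ_pos)
    simpa using h
  · have h := tendsto_forestSquareSum_two
    have hne : ∀ᶠ n : ℕ in atTop,
        (1 / 2 : ℝ) * Real.sqrt (Real.pi / 2) * (n : ℝ) ^ (5 / 2 : ℝ) ≠ 0 := by
      filter_upwards [eventually_gt_atTop 0] with n hn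
      positivity
    exact (isEquivalent_iff_tendsto_one hne).1
      ((averageBallSize_isEquivalent 1).trans ((isEquivalent_iff_tendsto_one hne).2 h))
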